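/- Let $n\ge 2$ and let $a,c$ be nonnegative integers. Put $N=(a-1)n+c\binom n2$ and $e_1=x_1+x_2+\cdots+x_n$. Work in the field $\mathbb{Q}((x_n))((x_{n-1}))\cdots((x_1))$ of iterated formal Laurent series, whose elements are Laurent series in $x_1$ with coefficients in $\mathbb{Q}((x_n))\cdots((x_2))$ (so for $i<j$ one expands $(x_j-x_i)^{-1}=x_j^{-1}\sum_{k\ge 0}(x_i/x_j)^k$), and let $\operatorname{CT}_{x_n}\cdots\operatorname{CT}_{x_1}$ denote the iterated constant term, in which the coefficient of $x_1^0$ is taken first, then that of $x_2^0$, and so on. Define $$L_n(a,c)=\operatorname{CT}_{x_n}\cdots\operatorname{CT}_{x_1}\; e_1^{\,(a-1)n+c\binom n2}\ \prod_{i=1}^n x_i^{1-a}\prod_{1\le i<j\le n}(x_j-x_i)^{-c}.$$ If $N\ge 0$, then $$L_n(a,c)=\Big((a-1)n+c\tbinom n2\Big)!\;\prod_{i=0}^{n-1}\frac{\Gamma(1+c/2)}{\Gamma\big(1+(i+1)c/2\big)\,\Gamma\big(a+ic/2\big)},$$ where $1/\Gamma(0)$ is read as $0$ (this occurs only for $a=0$).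 If $N<0$ (which happens only for $a=0$ and $c(n-1)<2$), then $L_n(a,c)=0$. The same formulas hold for the iterated constant term of $$e_1^{\,(a-1)n+c\binom n2}\ \prod_{i=1}^n x_i^{1-a}\prod_{1\le i<j\le n}(x_i-x_j)^{-c}$$ when the variables are taken in the opposite order, that is, in the field $\mathbb{Q}((x_1))((x_2))\cdots((x_n))$, where for $i<j$ one expands $(x_i-x_j)^{-1}=x_i^{-1}\sum_{k\ge 0}(x_j/x_i)^k$. -/

import Mathlib

open scoped Nat

noncomputable section

/-- The tower of iterated Laurent series fields over `ℚ`, each with its field structure: level `0` is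
`ℚ`, and level `n + 1` is the field of formal Laurent series in one new (outermost) variable over
level `n`. -/
def iterLaurentTower : ℕ → (K : Type) × Field K
  | 0 => ⟨ℚ, inferInstance⟩
  | n + 1 =>
    letI : Field (iterLaurentTower n).1 := (iterLaurentTower n).2
    ⟨LaurentSeries (iterLaurentTower n).1, inferInstance⟩

/-- The field `ℚ((x_n))((x_{n-1}))⋯((x_1))` of iterated formal Laurent series in `n` variables.
Its elements are Laurent series in `x_1` whose coefficients are iterated Laurent series in the
remaining variables, so that `x_1` is infinitesimally small compared with `x_2`, and so on. -/
def IterLaurent (n : ℕ) : Type := (iterLaurentTower n).1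

instance instFieldIterLaurent (n : ℕ) : Field (IterLaurent n) := (iterLaurentTower n).2

/-- The variable `x_{i+1}` (indices in `Fin n` start at `0`). -/
def iterVar : (n : ℕ) → Fin n → IterLaurent n
  | 0 => Fin.elim0
  | n + 1 => Fin.cases
      (HahnSeries.single (1 : ℤ) (1 : IterLaurent n) : LaurentSeries (IterLaurent n))
      (fun i => (HahnSeries.C (iterVar n i) : LaurentSeries (IterLaurent n)))

/-- The iterated constant term `CT_{x_n} ⋯ CT_{x_1}`: first take the coefficient of `x_1 ^ 0`, then
the constant term of the result in the remaining variables. -/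
def iterCT : (n : ℕ) → IterLaurent n → ℚ
  | 0 => fun q => q
  | n + 1 => fun f =>
      iterCT n (HahnSeries.coeff (show LaurentSeries (IterLaurent n) from f) (0 : ℤ))

/-- The integer `(a - 1) n + c * binom(n, 2)`. -/
def morrisDegree (n a c : ℕ) : ℤ := ((a : ℤ) - 1) * n + c * (n.choose 2 : ℤ)

/-- `L_n(a,c)`, the iterated constant term (with `x_1` the smallest variable) of
`e_1 ^ ((a-1)n + c binom(n,2)) * ∏ x_i ^ (1-a) * ∏_{i<j} (x_j - x_i) ^ (-c)`. -/
def morrisL (n a c : ℕ) : ℚ :=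
  iterCT n
    ((∑ i, iterVar n i) ^ morrisDegree n a c
      * (∏ i, iterVar n i ^ (1 - (a : ℤ)))
      * ∏ i, ∏ j ∈ Finset.Ioi i, (iterVar n j - iterVar n i) ^ (-(c : ℤ)))

/-- The variable `x_{i+1}` in the field `ℚ((x_1))((x_2))⋯((x_n))`, in which the order of the
variables is reversed: `x_n` is now the outermost and smallest variable. -/
def iterVarRev (n : ℕ) (i : Fin n) : IterLaurent n := iterVar n i.rev

/-- The iterated constant term in `ℚ((x_1))((x_2))⋯((x_n))` (with `x_n` the smallest variable) of
`e_1 ^ ((a-1)n + c binom(n,2)) * ∏ x_i ^ (1-a) * ∏_{i<j} (x_i - x_j) ^ (-c)`. -/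
def morrisLRev (n a c : ℕ) : ℚ :=
  iterCT n
    ((∑ i, iterVarRev n i) ^ morrisDegree n a c
      * (∏ i, iterVarRev n i ^ (1 - (a : ℤ)))
      * ∏ i, ∏ j ∈ Finset.Ioi i, (iterVarRev n i - iterVarRev n j) ^ (-(c : ℤ)))

/-- `N! ∏_{i=0}^{n-1} Γ(1+c/2) / (Γ(1+(i+1)c/2) Γ(a+ic/2))`. The only pole among the Gamma values is
`Γ(0)`, which occurs in the denominator when `a = 0`; there `1 / Γ(0) = 0`, which is also the value
given by `Real.Gamma 0 = 0`. -/
def morrisProduct (n a c N : ℕ) : ℝ :=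
  (N ! : ℝ) * ∏ i ∈ Finset.range n,
    Real.Gamma (1 + (c : ℝ) / 2)
      / (Real.Gamma (1 + ((i : ℝ) + 1) * c / 2) * Real.Gamma ((a : ℝ) + i * c / 2))

end

/-! Let `F_n(a, M)` be the constant term of `e_1^M / M!` times the weight with exponents `-a`, `-c`
(`normalizedCT`). Two relations determine it for `M = a n + c binom(n,2)`. Raising `a`: constant
terms of Euler derivatives vanish. Apply `x_{σ k} ∂/∂x_{σ k}` to the integrand times `x_{σ 0} ⋯ x_{σ
(k-1)}` and sum over `σ`; the symmetrized differences collapse to a scalar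
(`two_mul_sum_permProd_mul_sum_div`), which gives `aomoto_recurrence`. Its `n` steps relate `F_n(a,
M)` to `F_n(a+1, M+n)`. Lowering `n`: at `a = 0` the integrand is a power series in `x_1`, and
setting `x_1 = 0` gives `F_{n-1}(c, M)` (`normalizedCT_zero`). The Gamma product obeys the same
relations. The theorem's `a` is one more than the `a` here; its case `a = 0` vanishes separately. -/

/-- Apply an additive map, which may depend on the degree, to each coefficient of a Laurent series. -/
noncomputable def coeffwise {K : Type*} [Field K] (d : ℤ → K →+ K) :
    LaurentSeries K →+ LaurentSeries K :=
  AddMonoidHom.mk' (fun f =>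
    { coeff := fun g => d g (f.coeff g)
      isPWO_support' := f.isPWO_support.mono fun g hg h => hg (by simp [h]) })
    fun f g => by ext k; simp

theorem coeffwise_coeff {K : Type*} [Field K] (d : ℤ → K →+ K) (f : LaurentSeries K) (g : ℤ) :
    (coeffwise d f).coeff g = d g (f.coeff g) := rfl

theorem coeffwise_single {K : Type*} [Field K] (d : ℤ → K →+ K) (g : ℤ) (r : K) :
    coeffwise d (HahnSeries.single g r) = HahnSeries.single g (d g r) := by
  ext k
  rw [coeffwise_coeff]
  by_cases h : k = g
  · simp [h]
  · simp [HahnSeries.coeff_single_of_ne h]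

/-- If the family of maps satisfies a graded Leibniz rule, then `coeffwise` is a derivation. -/
theorem coeffwise_mul {K : Type*} [Field K] (d : ℤ → K →+ K)
    (hd : ∀ g h r s, d (g + h) (r * s) = r * d h s + s * d g r) (f g : LaurentSeries K) :
    coeffwise d (f * g) = f * coeffwise d g + g * coeffwise d f := by
  have hD : ∀ f : LaurentSeries K, (coeffwise d f).support ⊆ f.support := fun f g hg h =>
    hg (by simp [coeffwise_coeff, h])
  rw [mul_comm g]
  ext k
  -- Supports only shrink, so all three sums can run over the antidiagonal of the supports of `f`
  -- and `g`.
  rw [HahnSeries.coeff_add, HahnSeries.coeff_mul_left' f.isPWO_support (hD f),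
    HahnSeries.coeff_mul_right' g.isPWO_support (hD g), ← Finset.sum_add_distrib,
    coeffwise_coeff, HahnSeries.coeff_mul, map_sum]
  refine Finset.sum_congr rfl fun ij hij => ?_
  rw [← (Finset.mem_antidiagonal.1 hij).2.2, hd, coeffwise_coeff, coeffwise_coeff,
    mul_comm (g.coeff ij.2)]

/-! ### Setting the outermost variable to zero -/

/-- `f` is a Laurent series without negative powers, with constant coefficient `r`. -/
def HasConst {K : Type*} [Field K] (f : LaurentSeries K) (r : K) : Prop :=
  ∃ p : PowerSeries K, HahnSeries.ofPowerSeries ℤ K p = f ∧ PowerSeries.constantCoeff p = r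

namespace HasConst

variable {K : Type*} [Field K] {f g : LaurentSeries K} {r s : K}

theorem coeff_zero (h : HasConst f r) : f.coeff 0 = r := by
  obtain ⟨p, rfl, rfl⟩ := h
  simpa using LaurentSeries.coeff_coe_powerSeries p 0

theorem mul (hf : HasConst f r) (hg : HasConst g s) : HasConst (f * g) (r * s) := by
  obtain ⟨p, rfl, rfl⟩ := hf
  obtain ⟨q, rfl, rfl⟩ := hg
  exact ⟨p * q, map_mul _ _ _, map_mul _ _ _⟩

theorem add (hf : HasConst f r) (hg : HasConst g s) : HasConst (f + g) (r + s) := by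
  obtain ⟨p, rfl, rfl⟩ := hf
  obtain ⟨q, rfl, rfl⟩ := hg
  exact ⟨p + q, map_add _ _ _, map_add _ _ _⟩

theorem sub (hf : HasConst f r) (hg : HasConst g s) : HasConst (f - g) (r - s) := by
  obtain ⟨p, rfl, rfl⟩ := hf
  obtain ⟨q, rfl, rfl⟩ := hg
  exact ⟨p - q, map_sub _ _ _, map_sub _ _ _⟩

theorem C (r : K) : HasConst (HahnSeries.C r : LaurentSeries K) r :=
  ⟨PowerSeries.C r, HahnSeries.ofPowerSeries_C r, PowerSeries.constantCoeff_C r⟩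

theorem X : HasConst (HahnSeries.single (1 : ℤ) (1 : K) : LaurentSeries K) 0 :=
  ⟨PowerSeries.X, HahnSeries.ofPowerSeries_X, PowerSeries.constantCoeff_X⟩

theorem pow (hf : HasConst f r) (m : ℕ) : HasConst (f ^ m) (r ^ m) := by
  obtain ⟨p, rfl, rfl⟩ := hf
  exact ⟨p ^ m, map_pow _ _ _, map_pow _ _ _⟩

theorem inv (hf : HasConst f r) (hr : r ≠ 0) : HasConst f⁻¹ r⁻¹ := by
  obtain ⟨p, rfl, rfl⟩ := hf
  refine ⟨p⁻¹, ?_, PowerSeries.constantCoeff_inv p⟩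
  refine eq_inv_of_mul_eq_one_left ?_
  rw [← map_mul, PowerSeries.inv_mul_cancel p hr, map_one]

theorem zpow (hf : HasConst f r) (hr : r ≠ 0) (m : ℤ) : HasConst (f ^ m) (r ^ m) := by
  obtain ⟨m, rfl | rfl⟩ := m.eq_nat_or_neg
  · simpa using hf.pow m
  · simpa using (hf.pow m).inv (pow_ne_zero m hr)

theorem sum {ι : Type*} (t : Finset ι) {f : ι → LaurentSeries K} {r : ι → K}
    (h : ∀ i ∈ t, HasConst (f i) (r i)) : HasConst (∑ i ∈ t, f i) (∑ i ∈ t, r i) := by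
  choose! p hp hr using h
  exact ⟨∑ i ∈ t, p i, by rw [map_sum, Finset.sum_congr rfl hp],
    by rw [map_sum, Finset.sum_congr rfl hr]⟩

theorem prod {ι : Type*} (t : Finset ι) {f : ι → LaurentSeries K} {r : ι → K}
    (h : ∀ i ∈ t, HasConst (f i) (r i)) : HasConst (∏ i ∈ t, f i) (∏ i ∈ t, r i) := by
  choose! p hp hr using h
  exact ⟨∏ i ∈ t, p i, by rw [map_prod, Finset.prod_congr rfl hp],
    by rw [map_prod, Finset.prod_congr rfl hr]⟩

end HasConst

/-! ### Iterated constant terms and Euler derivations -/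

theorem iterVar_zero_hasConst (n : ℕ) :
    HasConst (K := IterLaurent n) (iterVar (n + 1) 0) 0 := HasConst.X

theorem iterVar_succ_hasConst (n : ℕ) (i : Fin n) :
    HasConst (K := IterLaurent n) (iterVar (n + 1) i.succ) (iterVar n i) := HasConst.C _

theorem iterCT_of_hasConst {n : ℕ} {f : IterLaurent (n + 1)} {r : IterLaurent n}
    (h : HasConst (K := IterLaurent n) f r) : iterCT (n + 1) f = iterCT n r :=
  congrArg (iterCT n) h.coeff_zero

theorem iterCT_add (n : ℕ) (f g : IterLaurent n) :
    iterCT n (f + g) = iterCT n f + iterCT n g := by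
  induction n with
  | zero => rfl
  | succ n ih => exact ih _ _

/-- The iterated constant term as an additive map. -/
noncomputable def iterCTHom (n : ℕ) : IterLaurent n →+ ℚ := AddMonoidHom.mk' (iterCT n) (iterCT_add n)

/-- Euler derivations of `K` extend to `K((X))`, and `X d/dX` is a further one. -/
theorem exists_eulerHom_laurentSeries {K : Type*} [Field K] {n : ℕ} (x : Fin n → K) (ct : K → ℚ)
    (hct : ct 0 = 0)
    (ih : ∀ i, ∃ D : K →+ K, (∀ f g, D (f * g) = f * D g + g * D f) ∧
      (∀ j, D (x j) = if j = i then x i else 0) ∧ ∀ f, ct (D f) = 0)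
    (y : Fin (n + 1) → LaurentSeries K) (hy0 : y 0 = HahnSeries.single 1 1)
    (hy : ∀ i : Fin n, y i.succ = HahnSeries.C (x i)) (i : Fin (n + 1)) :
    ∃ D : LaurentSeries K →+ LaurentSeries K, (∀ f g, D (f * g) = f * D g + g * D f) ∧
      (∀ j, D (y j) = if j = i then y i else 0) ∧ ∀ f, ct ((D f).coeff 0) = 0 := by
  cases i using Fin.cases with
  | zero =>
    -- `X d/dX` multiplies the coefficient of degree `g` by `g`, so it kills degree `0`.
    refine ⟨coeffwise fun g => zsmulAddGroupHom g,
      coeffwise_mul _ fun g h r s => ?_, fun j => ?_, fun f => ?_⟩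
    · simp only [zsmulAddGroupHom_apply, zsmul_eq_mul]; push_cast; ring
    · cases j using Fin.cases with
      | zero => simp [hy0, coeffwise_single]
      | succ j =>
        rw [hy, if_neg (Fin.succ_ne_zero j), HahnSeries.C_apply, coeffwise_single]
        simp
    · simpa [coeffwise_coeff] using hct
  | succ i =>
    obtain ⟨D, hL, hD, hCT⟩ := ih i
    have hD1 : D 1 = 0 := by simpa using hL 1 1
    refine ⟨coeffwise fun _ => D, coeffwise_mul _ fun _ _ => hL, fun j => ?_, fun f => hCT _⟩
    cases j using Fin.cases with
    | zero => rw [hy0, coeffwise_single, hD1, if_neg (Fin.succ_ne_zero i).symm]; simp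
    | succ j =>
      rw [hy, hy, HahnSeries.C_apply, coeffwise_single, hD]
      by_cases h : j = i <;> simp [h]

theorem exists_eulerHom (n : ℕ) (i : Fin n) :
    ∃ D : IterLaurent n →+ IterLaurent n, (∀ f g, D (f * g) = f * D g + g * D f) ∧
      (∀ j, D (iterVar n j) = if j = i then iterVar n i else 0) ∧ ∀ f, iterCT n (D f) = 0 := by
  induction n with
  | zero => exact i.elim0
  | succ n ih =>
    exact exists_eulerHom_laurentSeries (K := IterLaurent n) (iterVar n) (iterCT n)
      (map_zero (iterCTHom n)) ih (iterVar (n + 1)) rfl (fun _ => rfl) i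

/-- The Euler derivation `x_i ∂/∂x_i`. -/
theorem exists_eulerDerivation (n : ℕ) (i : Fin n) :
    ∃ D : Derivation ℤ (IterLaurent n) (IterLaurent n),
      (∀ j, D (iterVar n j) = if j = i then iterVar n i else 0) ∧ ∀ f, iterCT n (D f) = 0 := by
  obtain ⟨D, hL, hD, hCT⟩ := exists_eulerHom n i
  exact ⟨Derivation.mk' D.toIntLinearMap hL, hD, hCT⟩

theorem iterVar_ne_zero (n : ℕ) (i : Fin n) : iterVar n i ≠ 0 := by
  induction n with
  | zero => exact i.elim0
  | succ n ih =>
    cases i using Fin.cases with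
    | zero => exact HahnSeries.single_ne_zero (Γ := ℤ) (one_ne_zero (α := IterLaurent n))
    | succ i => exact HahnSeries.single_ne_zero (Γ := ℤ) (ih i)

theorem iterVar_injective (n : ℕ) : Function.Injective (iterVar n) := by
  induction n with
  | zero => exact fun i => i.elim0
  | succ n ih =>
    have h0 : ∀ i : Fin n, iterVar (n + 1) 0 ≠ iterVar (n + 1) i.succ := fun i h =>
      iterVar_ne_zero n i ((iterVar_succ_hasConst n i).coeff_zero.symm.trans
        (h ▸ (iterVar_zero_hasConst n).coeff_zero))
    intro i j h
    cases i using Fin.cases with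
    | zero =>
      cases j using Fin.cases with
      | zero => rfl
      | succ j => exact (h0 j h).elim
    | succ i =>
      cases j using Fin.cases with
      | zero => exact (h0 i h.symm).elim
      | succ j => exact congrArg _ (ih (HahnSeries.C_injective h))

theorem sum_iterVar_ne_zero (n : ℕ) : ∑ i, iterVar (n + 1) i ≠ 0 := by
  intro h
  rw [Fin.sum_univ_succ] at h
  have hs : ∑ i : Fin n, iterVar (n + 1) i.succ =
      (HahnSeries.single (0 : ℤ) (∑ i, iterVar n i) : LaurentSeries (IterLaurent n)) :=
    (map_sum (HahnSeries.C (Γ := ℤ) (R := IterLaurent n)) _ _).symm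
  rw [hs] at h
  have h1 : (HahnSeries.single (1 : ℤ) (1 : IterLaurent n) +
      HahnSeries.single (0 : ℤ) (∑ i, iterVar n i)).coeff 1 = 0 :=
    congrArg (fun z : LaurentSeries (IterLaurent n) => z.coeff 1) h
  rw [HahnSeries.coeff_add, HahnSeries.coeff_single_same,
    HahnSeries.coeff_single_of_ne one_ne_zero, add_zero] at h1
  exact one_ne_zero h1

/-! ### Symmetrization over permutations -/

section PermSum

variable {K : Type*} [Field K] {n : ℕ}

/-- The product of the first `k` of the permuted variables `x (σ 0), x (σ 1), …`. -/
def permProd (x : Fin n → K) (k : ℕ) (σ : Equiv.Perm (Fin n)) : K :=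
  ∏ i ∈ Finset.univ.filter (fun i : Fin n => (i : ℕ) < k), x (σ i)

theorem permProd_succ (x : Fin n → K) (k : Fin n) (σ : Equiv.Perm (Fin n)) :
    permProd x (k + 1) σ = permProd x k σ * x (σ k) := by
  have h : Finset.univ.filter (fun i : Fin n => (i : ℕ) < k + 1) =
      insert k (Finset.univ.filter fun i : Fin n => (i : ℕ) < k) := by
    ext i; simp [Fin.ext_iff]; omega
  rw [permProd, h, Finset.prod_insert (by simp), mul_comm, permProd]

theorem permProd_mul_swap_of_lt (x : Fin n → K) {k j : Fin n} (h : k < j)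
    (σ : Equiv.Perm (Fin n)) :
    permProd x k (σ * Equiv.swap k j) = permProd x k σ := by
  refine Finset.prod_congr rfl fun i hi => ?_
  have hi : i < k := (Finset.mem_filter.1 hi).2
  rw [Equiv.Perm.mul_apply, Equiv.swap_apply_of_ne_of_ne hi.ne (hi.trans h).ne]

theorem permProd_mul_swap_of_gt (x : Fin n → K) {k j : Fin n} (h : j < k)
    (σ : Equiv.Perm (Fin n)) :
    permProd x k (σ * Equiv.swap k j) * x (σ j) = permProd x k σ * x (σ k) := by
  have hj : j ∈ Finset.univ.filter fun i : Fin n => (i : ℕ) < k := by simpa using h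
  rw [permProd, permProd, ← Finset.mul_prod_erase _ _ hj, ← Finset.mul_prod_erase _ _ hj,
    Equiv.Perm.mul_apply, Equiv.swap_apply_right, Finset.prod_congr rfl (g := fun i => x (σ i))]
  · ring
  · intro i hi
    obtain ⟨hij, hi⟩ := Finset.mem_erase.1 hi
    have hi : i < k := (Finset.mem_filter.1 hi).2
    rw [Equiv.Perm.mul_apply, Equiv.swap_apply_of_ne_of_ne hi.ne hij]

/-- Pair `σ` with `σ * swap k j`. For `k < j` the prefix product is unchanged and the two fractions
add to `1`; for `j < k` the numerators agree and the denominators are opposite; for `j = k` the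
fraction is `x / 0 = 0`. -/
theorem two_mul_sum_permProd_mul_div {x : Fin n → K} (hx : Function.Injective x) (k j : Fin n) :
    2 * ∑ σ, permProd x k σ * (x (σ k) / (x (σ k) - x (σ j))) =
      if k < j then ∑ σ, permProd x k σ else 0 := by
  have hsum := Equiv.sum_comp (Equiv.mulRight (Equiv.swap k j))
    fun σ => permProd x k σ * (x (σ k) / (x (σ k) - x (σ j)))
  rw [two_mul]
  nth_rewrite 1 [← hsum]
  rw [← Finset.sum_add_distrib]
  simp only [Equiv.coe_mulRight, Equiv.Perm.mul_apply, Equiv.swap_apply_left,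
    Equiv.swap_apply_right]
  rcases lt_trichotomy k j with h | rfl | h
  · rw [if_pos h]
    refine Finset.sum_congr rfl fun σ _ => ?_
    have h1 : x (σ k) - x (σ j) ≠ 0 := sub_ne_zero.2 fun e => h.ne (σ.injective (hx e))
    have h2 : x (σ j) - x (σ k) ≠ 0 := sub_ne_zero.2 fun e => h.ne' (σ.injective (hx e))
    rw [permProd_mul_swap_of_lt x h, ← mul_add]
    convert mul_one _ using 2
    field_simp
    ring
  · simp
  · rw [if_neg h.not_gt]
    refine Finset.sum_eq_zero fun σ _ => ?_
    rw [← mul_div_assoc, ← mul_div_assoc, permProd_mul_swap_of_gt x h,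
      ← neg_sub (x (σ k)), div_neg, neg_add_cancel]

/-- The symmetrization step of Aomoto's method. -/
theorem two_mul_sum_permProd_mul_sum_div {x : Fin n → K} (hx : Function.Injective x) (k : Fin n) :
    2 * ∑ σ, permProd x k σ * ∑ j, x (σ k) / (x (σ k) - x j) =
      ((n - 1 - k : ℕ) : K) * ∑ σ, permProd x k σ := by
  have h : ∀ σ : Equiv.Perm (Fin n), permProd x k σ * ∑ j, x (σ k) / (x (σ k) - x j) =
      ∑ j, permProd x k σ * (x (σ k) / (x (σ k) - x (σ j))) := fun σ => by
    rw [← Equiv.sum_comp σ, Finset.mul_sum]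
  simp_rw [h]
  rw [Finset.sum_comm, Finset.mul_sum]
  simp_rw [two_mul_sum_permProd_mul_div hx]
  rw [← Finset.sum_filter, Finset.sum_const, nsmul_eq_mul]
  congr 2
  rw [← Fin.card_Ioi]
  congr 1
  ext; simp

theorem sum_permProd_zero (x : Fin n → K) : ∑ σ, permProd x 0 σ = (n ! : K) := by
  simp [permProd, Finset.card_univ, Fintype.card_perm]

theorem sum_permProd_self (x : Fin n → K) : ∑ σ, permProd x n σ = (n ! : K) * ∏ i, x i := by
  have h : ∀ σ : Equiv.Perm (Fin n), permProd x n σ = ∏ i, x i := fun σ => by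
    rw [permProd, Finset.filter_true_of_mem fun i _ => i.2, Equiv.prod_comp σ x]
  simp [h, Finset.card_univ, Fintype.card_perm]

end PermSum

/-! ### Logarithmic derivatives and Aomoto's recurrence -/

namespace Derivation

variable {K : Type*} [Field K] (D : Derivation ℤ K K)

theorem apply_mul_of_eq_mul {f g r s : K} (hf : D f = f * r) (hg : D g = g * s) :
    D (f * g) = f * g * (r + s) := by
  rw [D.leibniz, hf, hg, smul_eq_mul, smul_eq_mul]; ring

theorem apply_prod_of_eq_mul {ι : Type*} (t : Finset ι) {f r : ι → K}
    (h : ∀ i ∈ t, D (f i) = f i * r i) : D (∏ i ∈ t, f i) = (∏ i ∈ t, f i) * ∑ i ∈ t, r i := by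
  classical
  induction t using Finset.induction_on with
  | empty => simp
  | insert i t hi ih =>
    rw [Finset.prod_insert hi, Finset.sum_insert hi]
    exact D.apply_mul_of_eq_mul (h i (by simp)) (ih fun j hj => h j (by simp [hj]))

theorem apply_zpow_of_eq_mul {f r : K} (hf0 : f ≠ 0) (hf : D f = f * r) (m : ℤ) :
    D (f ^ m) = f ^ m * (m * r) := by
  rw [D.leibniz_zpow, hf, smul_eq_mul, zsmul_eq_mul, zpow_sub_one₀ hf0]
  field_simp

end Derivation

/-- The weight `∏ x_i ^ (-a) * ∏_{i<j} (x_j - x_i) ^ (-c)`. -/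
def morrisWeight {K : Type*} [Field K] {n : ℕ} (x : Fin n → K) (a c : ℕ) : K :=
  (∏ i, x i ^ (-(a : ℤ))) * ∏ i, ∏ j ∈ Finset.Ioi i, (x j - x i) ^ (-(c : ℤ))

section Aomoto

variable {K : Type*} [Field K] {n : ℕ} {x : Fin n → K} (D : Derivation ℤ K K) {i : Fin n}

theorem Derivation.morrisWeight_apply (hx : Function.Injective x) (hx0 : ∀ j, x j ≠ 0)
    (hD : ∀ j, D (x j) = if j = i then x i else 0) (a c : ℕ) :
    D (morrisWeight x a c) = morrisWeight x a c * (-a - c * ∑ j, x i / (x i - x j)) := by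
  have h1 : D (∏ j, x j ^ (-(a : ℤ))) = (∏ j, x j ^ (-(a : ℤ))) * (-a) := by
    refine (D.apply_prod_of_eq_mul _ (r := fun j => if j = i then -(a : K) else 0)
      fun j _ => ?_).trans ?_
    · rw [D.apply_zpow_of_eq_mul (hx0 j) (r := if j = i then 1 else 0)]
      · split_ifs <;> simp
      · rw [hD]; split_ifs with h <;> simp [h]
    · simp
  -- The logarithmic derivative of `x m - x l`: the sign is absorbed by always writing `x i` first
  -- in the denominator.
  let r : Fin n → Fin n → K := fun l m => if m = i then x i / (x i - x l) else
    if l = i then x i / (x i - x m) else 0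
  have h2 : D (∏ l, ∏ m ∈ Finset.Ioi l, (x m - x l) ^ (-(c : ℤ))) =
      (∏ l, ∏ m ∈ Finset.Ioi l, (x m - x l) ^ (-(c : ℤ))) *
        ∑ l, ∑ m ∈ Finset.Ioi l, (-c) * r l m := by
    refine D.apply_prod_of_eq_mul _ fun l _ => D.apply_prod_of_eq_mul _ fun m hm => ?_
    have hlm : l < m := Finset.mem_Ioi.1 hm
    have hne : x m - x l ≠ 0 := sub_ne_zero.2 fun e => hlm.ne' (hx e)
    rw [D.apply_zpow_of_eq_mul hne (r := r l m)]
    · push_cast; rfl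
    · rw [map_sub, hD, hD]
      by_cases hm : m = i
      · subst hm
        simp only [r, if_true, if_neg hlm.ne, sub_zero]
        field_simp
      · by_cases hl : l = i
        · subst hl
          simp only [r, if_true, if_neg hm, zero_sub]
          rw [← neg_sub (x m) (x l), div_neg]
          field_simp
        · simp [r, hm, hl]
  have h3 : ∑ l, ∑ m ∈ Finset.Ioi l, r l m = ∑ j, x i / (x i - x j) := by
    have h4 : ∀ l, ∑ m ∈ Finset.Ioi l, r l m = (if l < i then x i / (x i - x l) else 0) +
        if l = i then ∑ m ∈ Finset.Ioi i, x i / (x i - x m) else 0 := by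
      intro l
      by_cases hl : l = i
      · subst hl
        simp only [lt_self_iff_false, if_false, if_true, zero_add]
        exact Finset.sum_congr rfl fun m hm => by simp [r, (Finset.mem_Ioi.1 hm).ne']
      · simp only [r, hl, if_false, add_zero]
        rw [Finset.sum_ite_eq']
        simp
    simp_rw [h4]
    rw [Finset.sum_add_distrib, Finset.sum_ite_eq', if_pos (Finset.mem_univ _),
      ← Finset.sum_filter, ← Finset.sum_filter_add_sum_filter_not Finset.univ (fun l => l < i)]
    congr 1
    -- The extra index `m = i` contributes `x i / 0 = 0`.
    refine Finset.sum_subset (fun m hm => ?_) fun m hm hm' => ?_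
    · simpa using (Finset.mem_Ioi.1 hm).le
    · have h5 : m = i := le_antisymm (by simpa using hm') (by simpa using hm)
      simp [h5]
  rw [morrisWeight, D.apply_mul_of_eq_mul h1 h2]
  simp_rw [← Finset.mul_sum, h3]
  ring

theorem Derivation.permProd_apply_eq_zero (k : Fin n) (σ : Equiv.Perm (Fin n))
    (hD : ∀ j, D (x j) = if j = σ k then x (σ k) else 0) : D (permProd x k σ) = 0 := by
  refine (D.apply_prod_of_eq_mul _ (r := 0) fun i hi => ?_).trans ?_
  · have hi : i < k := (Finset.mem_filter.1 hi).2
    simp [hD, hi.ne]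
  · simp

theorem Derivation.apply_esymm_pow_mul (hx : Function.Injective x) (hx0 : ∀ j, x j ≠ 0)
    (k : Fin n) (σ : Equiv.Perm (Fin n))
    (hD : ∀ j, D (x j) = if j = σ k then x (σ k) else 0) (a c M : ℕ) :
    D ((∑ j, x j) ^ (M + 1) * morrisWeight x a c * permProd x k σ) =
      (M + 1) * ((∑ j, x j) ^ M * morrisWeight x a c * permProd x (k + 1) σ)
      - (∑ j, x j) ^ (M + 1) * morrisWeight x a c *
        (a * permProd x k σ + c * (permProd x k σ * ∑ j, x (σ k) / (x (σ k) - x j))) := by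
  have hs : D (∑ j, x j) = x (σ k) := by simp [hD]
  rw [D.leibniz, D.permProd_apply_eq_zero k σ hD, D.leibniz, D.leibniz_pow, hs,
    D.morrisWeight_apply hx hx0 hD, permProd_succ]
  simp only [smul_eq_mul, nsmul_eq_mul, Nat.add_sub_cancel]
  push_cast
  ring

/-- Aomoto's recurrence for an additive functional that kills all Euler derivatives. -/
theorem aomoto_recurrence (hx : Function.Injective x) (hx0 : ∀ j, x j ≠ 0) (ct : K →+ ℚ)
    (hct : ∀ i, ∃ D : Derivation ℤ K K,
      (∀ j, D (x j) = if j = i then x i else 0) ∧ ∀ f, ct (D f) = 0)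
    (a c M : ℕ) (k : Fin n) :
    2 * (M + 1) * ct ((∑ j, x j) ^ M * morrisWeight x a c * ∑ σ, permProd x (k + 1) σ) =
      (2 * a + c * (n - 1 - k : ℕ)) *
        ct ((∑ j, x j) ^ (M + 1) * morrisWeight x a c * ∑ σ, permProd x k σ) := by
  choose D hD hct using hct
  have h0 : ∑ σ : Equiv.Perm (Fin n), ct (D (σ k) ((∑ j, x j) ^ (M + 1) * morrisWeight x a c *
      permProd x k σ)) = 0 := Finset.sum_eq_zero fun σ _ => hct _ _
  simp_rw [fun σ => (D (σ k)).apply_esymm_pow_mul hx hx0 k σ (hD _) a c M] at h0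
  rw [← map_sum, Finset.sum_sub_distrib, ← Finset.mul_sum, ← Finset.mul_sum, ← Finset.mul_sum,
    Finset.sum_add_distrib, ← Finset.mul_sum, ← Finset.mul_sum] at h0
  -- Doubling clears the `1/2` of the symmetrization: `ct` is only additive, so scalars must be
  -- natural numbers to pass through it.
  have h1 := congrArg (fun q : ℚ => 2 • q) h0
  simp only [smul_zero] at h1
  rw [← map_nsmul] at h1
  set E := ∑ j, x j
  set w := morrisWeight x a c
  set P := ∑ σ, permProd x k σ
  set P' := ∑ σ, permProd x (k + 1) σ
  have h2 : 2 • (((M : K) + 1) * (E ^ M * w * P') - E ^ (M + 1) * w *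
      (a * P + c * ∑ σ, permProd x k σ * ∑ j, x (σ k) / (x (σ k) - x j))) =
      (2 * (M + 1)) • (E ^ M * w * P') - (2 * a + c * (n - 1 - k)) • (E ^ (M + 1) * w * P) := by
    have h3 := two_mul_sum_permProd_mul_sum_div hx k
    simp only [nsmul_eq_mul]
    push_cast
    linear_combination (-(E ^ (M + 1) * w * c)) * h3
  rw [h2, map_sub, map_nsmul, map_nsmul, sub_eq_zero, nsmul_eq_mul, nsmul_eq_mul] at h1
  exact_mod_cast h1

end Aomoto

/-! ### Raising `a` by one -/

theorem morrisWeight_succ_mul_prod {K : Type*} [Field K] {n : ℕ} {x : Fin n → K}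
    (hx0 : ∀ j, x j ≠ 0) (a c : ℕ) :
    morrisWeight x (a + 1) c * ∏ i, x i = morrisWeight x a c := by
  rw [morrisWeight, morrisWeight, mul_right_comm, ← Finset.prod_mul_distrib]
  congr 1
  refine Finset.prod_congr rfl fun i _ => ?_
  rw [← zpow_add_one₀ (hx0 i)]
  congr 1
  push_cast
  ring

/-- The iterated constant term of `e_1 ^ M / M! * ∏ x_i ^ (-a) * ∏_{i<j} (x_j - x_i) ^ (-c)`. -/
noncomputable def normalizedCT (n a c M : ℕ) : ℚ :=
  iterCT n ((∑ i, iterVar n i) ^ M * morrisWeight (iterVar n) a c) / M !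

theorem iterCT_natCast_mul (n m : ℕ) (f : IterLaurent n) :
    iterCT n (m * f) = m * iterCT n f := by
  have h := map_nsmul (iterCTHom n) m f
  rw [nsmul_eq_mul, nsmul_eq_mul] at h
  exact h

/-- Each use of the recurrence trades one power of `e_1` for one more variable in the prefix
product. -/
theorem iterCT_permProd (n a c N k : ℕ) (hk : k ≤ n) :
    iterCT n ((∑ i, iterVar n i) ^ (N + n - k) * morrisWeight (iterVar n) a c *
        ∑ σ, permProd (iterVar n) k σ) / (N + n - k)! =
      (∏ i ∈ Finset.range k, ((a : ℚ) + (n - 1 - i : ℕ) * c / 2)) *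
        (n ! * normalizedCT n a c (N + n)) := by
  induction k with
  | zero =>
    rw [sum_permProd_zero, mul_comm, iterCT_natCast_mul]
    simp [normalizedCT]
    ring
  | succ k ih =>
    have h := aomoto_recurrence (iterVar_injective n) (iterVar_ne_zero n) (iterCTHom n)
      (exists_eulerDerivation n) a c (N + n - (k + 1)) ⟨k, hk⟩
    obtain ⟨M, hM⟩ : ∃ M, N + n - (k + 1) = M := ⟨_, rfl⟩
    have hM' : N + n - k = M + 1 := by omega
    have ih := ih (by omega)
    rw [hM'] at ih
    rw [hM] at h ⊢
    change 2 * ((M : ℚ) + 1) * iterCT n _ = _ * iterCT n _ at h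
    rw [Finset.prod_range_succ, mul_right_comm (∏ i ∈ Finset.range k, _), ← ih,
      Nat.factorial_succ]
    have hM0 : (M : ℚ) + 1 ≠ 0 := by positivity
    have hM1 : (M ! : ℚ) ≠ 0 := by positivity
    simp only at h
    generalize iterCT n (_ * ∑ σ, permProd (iterVar n) (k + 1) σ) = A at h ⊢
    generalize iterCT n (_ * ∑ σ, permProd (iterVar n) k σ) = B at h ⊢
    push_cast
    field_simp
    linear_combination h

/-- At `k = n` the prefix product is `∏ x_i`, which cancels one power of each variable in the weight
for `a + 1`. -/
theorem normalizedCT_succ (n a c N : ℕ) :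
    normalizedCT n a c N =
      (∏ i ∈ Finset.range n, ((a : ℚ) + 1 + i * c / 2)) * normalizedCT n (a + 1) c (N + n) := by
  have h := iterCT_permProd n (a + 1) c N n le_rfl
  rw [sum_permProd_self, mul_left_comm, iterCT_natCast_mul, mul_assoc,
    morrisWeight_succ_mul_prod (iterVar_ne_zero n), Nat.add_sub_cancel,
    Finset.prod_range_reflect (fun i : ℕ => ((a + 1 : ℕ) : ℚ) + (i : ℚ) * c / 2)] at h
  have hn : (n ! : ℚ) ≠ 0 := by positivity
  refine mul_left_cancel₀ hn ?_
  rw [normalizedCT, ← mul_div_assoc, h]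
  push_cast
  ring

/-! ### Lowering `n` by one -/

section HasConst

variable {K : Type*} [Field K] {n : ℕ} {x : Fin n → K} {y : Fin (n + 1) → LaurentSeries K}

theorem hasConst_sum_vars (hy0 : HasConst (y 0) 0) (hy : ∀ i : Fin n, HasConst (y i.succ) (x i)) :
    HasConst (∑ i, y i) (∑ i, x i) := by
  rw [Fin.sum_univ_succ, ← zero_add (∑ i, x i)]
  exact hy0.add (HasConst.sum _ fun i _ => hy i)

theorem hasConst_prod_vars (hy0 : HasConst (y 0) 0) (hy : ∀ i : Fin n, HasConst (y i.succ) (x i)) :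
    HasConst (∏ i, y i) 0 := by
  rw [Fin.prod_univ_succ, ← zero_mul (∏ i, x i)]
  exact hy0.mul (HasConst.prod _ fun i _ => hy i)

/-- At `y 0 = 0` the pairs containing index `0` become `x i ^ (-c)`, which is why `c` appears as the
new `a`. -/
theorem hasConst_prod_sub (hy0 : HasConst (y 0) 0) (hy : ∀ i : Fin n, HasConst (y i.succ) (x i))
    (hx : Function.Injective x) (hx0 : ∀ i, x i ≠ 0) (c : ℕ) :
    HasConst (∏ i, ∏ j ∈ Finset.Ioi i, (y j - y i) ^ (-(c : ℤ))) (morrisWeight x c c) := by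
  rw [Fin.prod_univ_succ, Fin.Ioi_zero_eq_map, Finset.prod_map]
  refine (HasConst.prod _ fun i _ => ?_).mul (HasConst.prod _ fun i _ => ?_)
  · refine HasConst.zpow ?_ (hx0 i) _
    rw [← sub_zero (x i)]
    exact (hy i).sub hy0
  · rw [Fin.Ioi_succ, Finset.prod_map]
    exact HasConst.prod _ fun j hj => ((hy j).sub (hy i)).zpow
      (sub_ne_zero.2 fun h => (Finset.mem_Ioi.1 hj).ne' (hx h)) _

end HasConst

theorem normalizedCT_zero (n c M : ℕ) :
    normalizedCT (n + 1) 0 c M = normalizedCT n c c M := by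
  have h : morrisWeight (iterVar (n + 1)) 0 c =
      ∏ i, ∏ j ∈ Finset.Ioi i, (iterVar (n + 1) j - iterVar (n + 1) i) ^ (-(c : ℤ)) := by
    simp [morrisWeight]
  rw [normalizedCT, normalizedCT, h]
  congr 1
  exact iterCT_of_hasConst (((hasConst_sum_vars (iterVar_zero_hasConst n)
    (iterVar_succ_hasConst n)).pow M).mul (hasConst_prod_sub (iterVar_zero_hasConst n)
    (iterVar_succ_hasConst n) (iterVar_injective n) (iterVar_ne_zero n) c))

/-! ### Closed form and the theorem -/

theorem normalizedCT_eq (n a c : ℕ) :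
    (normalizedCT n a c (a * n + c * n.choose 2) : ℝ) = ∏ i ∈ Finset.range n,
      Real.Gamma (1 + (c : ℝ) / 2)
        / (Real.Gamma (1 + ((i : ℝ) + 1) * c / 2) * Real.Gamma ((a : ℝ) + 1 + i * c / 2)) := by
  induction n generalizing a with
  | zero =>
    have h : iterCT 0 1 = 1 := rfl
    simp [normalizedCT, morrisWeight, h]
  | succ n ihn =>
    induction a with
    | zero =>
      rw [normalizedCT_zero]
      have h := ihn c
      rw [show c * n + c * n.choose 2 = 0 * (n + 1) + c * (n + 1).choose 2 by
        rw [Nat.choose_succ_succ' n 1, Nat.choose_one_right]; ring] at h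
      rw [h, Finset.prod_div_distrib, Finset.prod_div_distrib, Finset.prod_mul_distrib,
        Finset.prod_mul_distrib]
      have hΓ : ∀ y : ℝ, 0 ≤ y → Real.Gamma (1 + y) ≠ 0 := fun y hy =>
        (Real.Gamma_pos_of_pos (by linarith)).ne'
      -- The Gamma products for `n` and `n + 1` agree after an index shift.
      have e1 : ∏ i ∈ Finset.range n, Real.Gamma ((c : ℝ) + 1 + i * c / 2) =
          ∏ i ∈ Finset.range n, Real.Gamma (1 + (((i + 1 : ℕ) : ℝ) + 1) * c / 2) :=
        Finset.prod_congr rfl fun i _ => by congr 1; push_cast; ring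
      have e2 : ∏ i ∈ Finset.range (n + 1), Real.Gamma (((0 : ℕ) : ℝ) + 1 + i * c / 2) =
          ∏ i ∈ Finset.range n, Real.Gamma (1 + ((i : ℝ) + 1) * c / 2) := by
        rw [Finset.prod_range_succ']
        simp
      rw [e1, e2, Finset.prod_range_succ' (fun i : ℕ => Real.Gamma (1 + ((i : ℝ) + 1) * c / 2)),
        Finset.prod_range_succ]
      have h1 : Real.Gamma (1 + (((0 : ℕ) : ℝ) + 1) * c / 2) = Real.Gamma (1 + (c : ℝ) / 2) := by
        simp
      have h2 : Real.Gamma (1 + (c : ℝ) / 2) ≠ 0 := hΓ _ (by positivity)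
      rw [h1]
      field_simp
    | succ a iha =>
      have h := congrArg (Rat.cast (K := ℝ))
        (normalizedCT_succ (n + 1) a c (a * (n + 1) + c * (n + 1).choose 2))
      rw [iha, show a * (n + 1) + c * (n + 1).choose 2 + (n + 1) =
        (a + 1) * (n + 1) + c * (n + 1).choose 2 by ring] at h
      have hpos : ∀ i : ℕ, (0 : ℝ) < (a : ℝ) + 1 + i * c / 2 := fun i => by positivity
      have hne : (∏ i ∈ Finset.range (n + 1), ((a : ℝ) + 1 + i * c / 2)) ≠ 0 :=
        Finset.prod_ne_zero_iff.2 fun i _ => (hpos i).ne'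
      refine mul_left_cancel₀ hne ?_
      push_cast at h
      rw [← h, ← Finset.prod_mul_distrib]
      refine Finset.prod_congr rfl fun i _ => ?_
      have e : ((a + 1 : ℕ) : ℝ) + 1 + i * c / 2 = ((a : ℝ) + 1 + i * c / 2) + 1 := by
        push_cast; ring
      rw [e, Real.Gamma_add_one (hpos i).ne']
      have := (hpos i).ne'
      field_simp

/-- The factor `∏ x_i` vanishes at `x_1 = 0`. With at least two variables, `e_1` keeps a nonzero
constant coefficient, so even a negative power of it is harmless. -/
theorem morrisL_zero (n c : ℕ) : morrisL (n + 2) 0 c = 0 := by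
  have hy0 := iterVar_zero_hasConst (n + 1)
  have hy := iterVar_succ_hasConst (n + 1)
  have h := (((hasConst_sum_vars hy0 hy).zpow (sum_iterVar_ne_zero n)
    (morrisDegree (n + 2) 0 c)).mul (hasConst_prod_vars hy0 hy)).mul
    (hasConst_prod_sub hy0 hy (iterVar_injective _) (iterVar_ne_zero _) c)
  rw [mul_zero, zero_mul] at h
  have h0 := (iterCT_of_hasConst h).trans (map_zero (iterCTHom (n + 1)))
  rw [morrisL]
  simp only [Nat.cast_zero, sub_zero, zpow_one]
  exact h0

theorem morrisDegree_succ (n a c : ℕ) :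
    morrisDegree n (a + 1) c = ((a * n + c * n.choose 2 : ℕ) : ℤ) := by
  simp [morrisDegree]

theorem morrisL_succ (n a c : ℕ) :
    morrisL n (a + 1) c =
      (a * n + c * n.choose 2)! * normalizedCT n a c (a * n + c * n.choose 2) := by
  have h : (1 : ℤ) - ((a + 1 : ℕ) : ℤ) = -(a : ℤ) := by push_cast; ring
  rw [normalizedCT, mul_div_cancel₀ _ (by positivity), morrisL, morrisDegree_succ, zpow_natCast,
    h, mul_assoc, morrisWeight]

theorem morrisLRev_eq (n a c : ℕ) : morrisLRev n a c = morrisL n a c := by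
  rw [morrisLRev, morrisL]
  simp only [iterVarRev]
  have h1 : ∑ i : Fin n, iterVar n i.rev = ∑ i, iterVar n i :=
    Equiv.sum_comp Fin.revPerm (iterVar n)
  have h2 : ∏ i : Fin n, iterVar n i.rev ^ (1 - (a : ℤ)) = ∏ i, iterVar n i ^ (1 - (a : ℤ)) :=
    Equiv.prod_comp Fin.revPerm fun i => iterVar n i ^ (1 - (a : ℤ))
  have h3 : ∏ i : Fin n, ∏ j ∈ Finset.Ioi i, (iterVar n i.rev - iterVar n j.rev) ^ (-(c : ℤ)) =
      ∏ i, ∏ j ∈ Finset.Ioi i, (iterVar n j - iterVar n i) ^ (-(c : ℤ)) := by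
    rw [Finset.prod_sigma', Finset.prod_sigma']
    -- Reversal turns a pair `i < j` into `j.rev < i.rev`.
    refine Finset.prod_nbij' (fun p => ⟨p.2.rev, p.1.rev⟩) (fun p => ⟨p.2.rev, p.1.rev⟩)
      ?_ ?_ ?_ ?_ ?_ <;> simp
  rw [h1, h2, h3]

theorem morrisProduct_zero (n c N : ℕ) : morrisProduct (n + 1) 0 c N = 0 := by
  rw [morrisProduct, Finset.prod_range_succ']
  simp [Real.Gamma_zero]

theorem mainTheorem2 (n : ℕ) (hn : 2 ≤ n) (a c : ℕ) :
    (∀ N : ℕ, (N : ℤ) = morrisDegree n a c →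
      (morrisL n a c : ℝ) = morrisProduct n a c N ∧
      (morrisLRev n a c : ℝ) = morrisProduct n a c N) ∧
    (morrisDegree n a c < 0 → morrisL n a c = 0 ∧ morrisLRev n a c = 0) := by
  rw [morrisLRev_eq]
  simp only [and_self]
  obtain ⟨n, rfl⟩ := Nat.exists_eq_add_of_le' hn
  cases a with
  | zero =>
    refine ⟨fun N _ => ?_, fun _ => morrisL_zero n c⟩
    rw [morrisL_zero, morrisProduct_zero, Rat.cast_zero]
  | succ a =>
    rw [morrisDegree_succ]
    refine ⟨fun N hN => ?_, fun h => absurd h (Int.natCast_nonneg _).not_gt⟩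
    rw [Int.ofNat_inj.1 hN, morrisL_succ, Rat.cast_mul, normalizedCT_eq, morrisProduct]
    push_cast
    rfl
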